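/- Let $k=\mathbb{R}$ or $\mathbb{C}$, let $\mathfrak{g}$ be a finite-dimensional Lie algebra over $k$ and let $\mathfrak{g}_0\subset\mathfrak{g}$ be a subalgebra. An ideal of $\mathfrak{g}$ is called \emph{characteristic} if it is stable under all derivations of $\mathfrak{g}$. The pair $(\mathfrak{g},\mathfrak{g}_0)$ is called \emph{maximal} if $\mathfrak{g}_0$ is a maximal proper subalgebra of $\mathfrak{g}$, \emph{effective} if $\mathfrak{g}_0$ contains no non-zero ideal of $\mathfrak{g}$, and \emph{almost effective} if $\mathfrak{g}_0$ contains no non-zero characteristic ideal of $\mathfrak{g}$. Suppose that the pair $(\mathfrak{g},\mathfrak{g}_0)$ is maximal and almost effective. Then it has one of the following forms. (1) There are a Lie algebra $\mathfrak{a}$ over $k$, a faithful simple $\mathfrak{a}$-module $V$, an integer $n\ge 1$, and an isomorphism of Lie algebras from $\mathfrak{g}$ onto the semidirect product $\mathfrak{a}\ltimes(V\otimes k^n)$ that maps $\mathfrak{g}_0$ onto $\mathfrak{a}\ltimes(V\otimes k^{n-1})$. Here $k^n$ is a trivial $\mathfrak{a}$-module, $V\otimes k^n$ is an abelian ideal on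 which $\mathfrak{a}$ acts through the module structure, and $k^{n-1}\subset k^n$ is the subspace of vectors whose last coordinate is zero. (2) $\mathfrak{g}$ is a semisimple Lie algebra, and $\mathfrak{g}_0$ is a maximal subalgebra of $\mathfrak{g}$ such that the pair $(\mathfrak{g},\mathfrak{g}_0)$ is effective. -/

import Mathlib

open scoped TensorProduct

universe u v

namespace LiePair

section Pairs

variable {k g : Type*} [CommRing k] [LieRing g] [LieAlgebra k g]

/-- An ideal of a Lie algebra is characteristic if it is stable under all derivations. -/
def IsCharacteristic (I : LieIdeal k g) : Prop :=
  ∀ D : LieDerivation k g g, ∀ x ∈ I, D x ∈ I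

/-- The pair `(g, g₀)` is effective: `g₀` contains no non-zero ideal of `g`. -/
def IsEffective (g₀ : LieSubalgebra k g) : Prop :=
  ∀ I : LieIdeal k g, (∀ x ∈ I, x ∈ g₀) → I = ⊥

/-- The pair `(g, g₀)` is almost effective: `g₀` contains no non-zero characteristic ideal
of `g`. -/
def IsAlmostEffective (g₀ : LieSubalgebra k g) : Prop :=
  ∀ I : LieIdeal k g, IsCharacteristic I → (∀ x ∈ I, x ∈ g₀) → I = ⊥

/-- The pair `(g, g₀)` is maximal: `g₀` is a maximal (proper) subalgebra of `g`. -/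
def IsMaximalPair (g₀ : LieSubalgebra k g) : Prop :=
  IsCoatom g₀

end Pairs

/-- A module `M` regarded as an abelian Lie algebra. -/
def AbelianLie (M : Type*) : Type _ := M

namespace AbelianLie

variable {k M : Type*} [CommRing k] [AddCommGroup M] [Module k M]

instance : AddCommGroup (AbelianLie M) := inferInstanceAs (AddCommGroup M)

instance : Module k (AbelianLie M) := inferInstanceAs (Module k M)

variable (k M) in
/-- The identity map from `M` to `M` regarded as an abelian Lie algebra. -/
def of : M ≃ₗ[k] AbelianLie M := LinearEquiv.refl k M

instance : LieRing (AbelianLie M) where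
  bracket _ _ := 0
  add_lie _ _ _ := (add_zero 0).symm
  lie_add _ _ _ := (add_zero 0).symm
  lie_self _ := rfl
  leibniz_lie _ _ _ := (add_zero 0).symm

theorem lie_eq_zero (x y : AbelianLie M) : ⁅x, y⁆ = 0 := rfl

instance : LieAlgebra k (AbelianLie M) where
  lie_smul c _ _ := (smul_zero c).symm

end AbelianLie

section SemidirectProduct

variable (k a M : Type*) [CommRing k] [LieRing a] [LieAlgebra k a]
  [AddCommGroup M] [Module k M] [LieRingModule a M] [LieModule k a M]

/-- The action of `a` on an `a`-module `M`, as an action by derivations on the abelian Lie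
algebra `M`. -/
def actionDerivation : a →ₗ⁅k⁆ LieDerivation k (AbelianLie M) (AbelianLie M) where
  toFun x :=
    { toLinearMap :=
        (AbelianLie.of k M).toLinearMap ∘ₗ LieModule.toEnd k a M x ∘ₗ
          (AbelianLie.of k M).symm.toLinearMap
      leibniz' := fun u v => by simp [AbelianLie.lie_eq_zero] }
  map_add' x y := by ext v; simp
  map_smul' c x := by ext v; simp
  map_lie' := by intro x y; ext v; simp [LieDerivation.lie_apply]

/-- The semidirect product of a Lie algebra `a` and an `a`-module `M`, in which `M` is an abelian
ideal and `⁅x, m⁆ = x • m` for `x` in `a` and `m` in `M`. -/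
abbrev Semidirect : Type _ :=
  LieAlgebra.SemiDirectSum (AbelianLie M) a (actionDerivation k a M)

variable {k a M}

theorem actionDerivation_apply (x : a) (m : M) :
    actionDerivation k a M x (AbelianLie.of k M m) = AbelianLie.of k M ⁅x, m⁆ := rfl

/-- The subalgebra of the semidirect product of `a` and `M` spanned by `a` and an `a`-submodule
`N` of `M`, that is, the semidirect product of `a` and `N`. -/
def Semidirect.sub (N : LieSubmodule k a M) : LieSubalgebra k (Semidirect k a M) where
  carrier := {x | (AbelianLie.of k M).symm x.left ∈ N}
  zero_mem' := N.zero_mem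
  add_mem' {x y} hx hy := N.add_mem hx hy
  smul_mem' c x hx := N.smul_mem c hx
  lie_mem' {x y} hx hy := by
    have h : (AbelianLie.of k M).symm ⁅x, y⁆.left =
        ⁅x.right, (AbelianLie.of k M).symm y.left⁆ -
          ⁅y.right, (AbelianLie.of k M).symm x.left⁆ := by
      rw [LieAlgebra.SemiDirectSum.lie_eq_mk, AbelianLie.lie_eq_zero, zero_add, map_sub]
      rfl
    change (AbelianLie.of k M).symm ⁅x, y⁆.left ∈ N
    rw [h]
    exact N.sub_mem (N.lie_mem hy) (N.lie_mem hx)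

end SemidirectProduct

section Isotypic

variable (k a V : Type*) [CommRing k] [LieRing a] [LieAlgebra k a]
  [AddCommGroup V] [Module k V] [LieRingModule a V] [LieModule k a V]

/-- The `a`-module `V ⊗ k ^ n`, where `k ^ n` is a trivial `a`-module. -/
abbrev Isotypic (n : ℕ) : Type _ :=
  V ⊗[k] TrivialLieModule k a (Fin n → k)

/-- The inclusion of the trivial `a`-module `k ^ n` in `k ^ (n + 1)` as the set of vectors with
last coordinate zero. -/
noncomputable def trivialIncl (n : ℕ) :
    TrivialLieModule k a (Fin n → k) →ₗ⁅k,a⁆ TrivialLieModule k a (Fin (n + 1) → k) where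
  toLinearMap :=
    (TrivialLieModule.equiv k a (Fin (n + 1) → k)).symm.toLinearMap ∘ₗ
      Function.ExtendByZero.linearMap k (Fin.castSucc : Fin n → Fin (n + 1)) ∘ₗ
        (TrivialLieModule.equiv k a (Fin n → k)).toLinearMap
  map_lie' := by
    intro x m
    simp [LieModule.IsTrivial.trivial]

/-- The submodule `V ⊗ k ^ n` of the `a`-module `V ⊗ k ^ (n + 1)`. -/
noncomputable def isotypicSub (n : ℕ) : LieSubmodule k a (Isotypic k a V (n + 1)) :=
  (TensorProduct.LieModule.map (LieModuleHom.id : V →ₗ⁅k,a⁆ V) (trivialIncl k a n)).range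

end Isotypic

end LiePair

/-! If the radical is zero, `g` is semisimple and all its derivations are inner, so all ideals are
characteristic and almost effective means effective.

Otherwise the radical yields a non-zero characteristic abelian ideal, and its centralizer `C` is
characteristic, abelian and its own centralizer (`exists_selfCentralizing`). As `C` is not contained
in `g₀`, maximality gives `g = g₀ + C` and makes `V = C / (C ∩ g₀)` simple. The common kernel of all
homomorphisms `C → V` is characteristic (`isCharacteristic_homKernel`) and lies in `g₀`, hence is
zero. So `C` is a power of `V`, and the quotient map can be taken as last coordinate
(`exists_bijective_pi`). A complement `A` of `C` inside `g₀` then gives `g = A ⋉ C`, with `g₀` the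
locus where the last coordinate vanishes.

Complements come from `exists_le_complement`, which shrinks a supplement by intersecting it with
automorphic images of `g₀`. This needs a non-zero ideal to have an automorphic image outside `g₀`:
the span of its images is stable under automorphisms, hence, on differentiating `exp (t D)`, under
derivations. -/

namespace LiePair

/-! ### Exponentials of derivations. -/

section Exponential

variable {k E : Type*} [RCLike k] [NormedAddCommGroup E] [NormedSpace k E] [CompleteSpace E]

open NormedSpace in
theorem hasDerivAt_exp_smul_apply (D : E →L[k] E) (x : E) (t : k) :
    HasDerivAt (fun s : k => exp (s • D) x) (D (exp (t • D) x)) t := by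
  let : NormedAlgebra ℚ (E →L[k] E) := NormedAlgebra.restrictScalars ℚ k _
  exact (hasDerivAt_exp_smul_const' D t).clm_apply (hasDerivAt_const t x) |>.congr_deriv (by simp)

open NormedSpace in
theorem hasDerivAt_exp_smul_apply_zero (D : E →L[k] E) (x : E) :
    HasDerivAt (fun s : k => exp (s • D) x) (D x) 0 :=
  (hasDerivAt_exp_smul_apply D x 0).congr_deriv (by simp)

open NormedSpace in
theorem exp_smul_exp_neg_smul (D : E →L[k] E) (t : k) (x : E) :
    exp (t • D) (exp (-t • D) x) = x := by
  let : NormedAlgebra ℚ (E →L[k] E) := NormedAlgebra.restrictScalars ℚ k _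
  rw [← mul_apply_eq_comp, ← exp_add_of_commute, ← add_smul]
  · simp
  · exact (Commute.refl D).smul_left t |>.smul_right (-t)

open NormedSpace in
/-- The exponential of a derivation of a bilinear product is multiplicative. -/
theorem exp_smul_map_bilin (B : E →L[k] E →L[k] E) (D : E →L[k] E)
    (hD : ∀ x y, D (B x y) = B (D x) y + B x (D y)) (t : k) (x y : E) :
    exp (t • D) (B x y) = B (exp (t • D) x) (exp (t • D) y) := by
  let : NormedAlgebra ℚ (E →L[k] E) := NormedAlgebra.restrictScalars ℚ k _
  -- The derivative of `F` vanishes by the Leibniz rule, so `F t = F 0`.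
  let F : k → E := fun s => exp (-s • D) (B (exp (s • D) x) (exp (s • D) y))
  have hF : ∀ s, HasDerivAt F 0 s := by
    intro s
    have h₁ := (B.hasFDerivAt.comp_hasDerivAt s (hasDerivAt_exp_smul_apply D x s)).clm_apply
      (hasDerivAt_exp_smul_apply D y s)
    have h₂ : HasDerivAt (fun u : k => exp (-u • D)) (-(exp (-s • D) * D)) s := by
      have := (hasDerivAt_exp_smul_const D (-s)).scomp s (hasDerivAt_neg s)
      simpa [Function.comp_def] using this
    refine (h₂.clm_apply h₁).congr_deriv ?_
    simp [hD]
  have h0 : F t = F 0 :=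
    is_const_of_deriv_eq_zero (fun s => (hF s).differentiableAt) (fun s => (hF s).deriv) t 0
  have h1 : exp (-t • D) (B (exp (t • D) x) (exp (t • D) y)) = B x y := by
    simpa [F] using h0
  rw [← h1, exp_smul_exp_neg_smul]

end Exponential

/-! ### Automorphisms and characteristic ideals. -/

section Automorphisms

variable {k g : Type*} [RCLike k] [LieRing g] [LieAlgebra k g] [Module.Finite k g]

/-- An ideal that is stable under all automorphisms of the Lie algebra is characteristic. -/
theorem isCharacteristic_of_forall_lieEquiv (I : LieIdeal k g)
    (hI : ∀ φ : g ≃ₗ⁅k⁆ g, ∀ x ∈ I, φ x ∈ I) : IsCharacteristic I := by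
  intro D x hx
  -- Coordinates supply the norm needed for the exponential.
  let b : g ≃ₗ[k] (Fin (Module.finrank k g) → k) := (Module.finBasis k g).equivFun
  let B := LinearMap.toContinuousBilinearMap
    (LinearMap.mk₂ k (fun u v => b ⁅b.symm u, b.symm v⁆)
      (by simp) (by simp) (by simp) (by simp))
  let D' := LinearMap.toContinuousLinearMap (b.toLinearMap ∘ₗ D.toLinearMap ∘ₗ b.symm.toLinearMap)
  have hB : ∀ u v, B u v = b ⁅b.symm u, b.symm v⁆ := fun _ _ => rfl
  have hD' : ∀ u, D' u = b (D (b.symm u)) := fun _ => rfl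
  have hDB : ∀ u v, D' (B u v) = B (D' u) v + B u (D' v) := by
    intro u v
    simp only [hB, hD', LinearEquiv.symm_apply_apply, LieDerivation.apply_lie_eq_add, map_add]
    exact add_comm _ _
  let φ : k → (g ≃ₗ⁅k⁆ g) := fun t =>
    { toFun := fun z => b.symm (NormedSpace.exp (t • D') (b z))
      invFun := fun z => b.symm (NormedSpace.exp (-t • D') (b z))
      map_add' := by simp
      map_smul' := by simp
      map_lie' := by
        intro z w
        have := exp_smul_map_bilin B D' hDB t (b z) (b w)
        simp only [hB, LinearEquiv.symm_apply_apply] at this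
        simp [this]
      left_inv := by
        intro z
        have := exp_smul_exp_neg_smul D' (-t) (b z)
        rw [neg_neg] at this
        simp [this]
      right_inv := by
        intro z
        simp [exp_smul_exp_neg_smul D' t (b z)] }
  by_contra hDx
  -- `f` vanishes on `I` but not at `D x`; yet `f (exp (s D) x)` is identically zero, and its
  -- derivative at `0` is `f (D x)`.
  obtain ⟨f, hf, hIf⟩ := Submodule.exists_le_ker_of_notMem (p := I.toSubmodule) hDx
  let f' := LinearMap.toContinuousLinearMap (f ∘ₗ b.symm.toLinearMap)
  have h : HasDerivAt (fun s : k => f' (NormedSpace.exp (s • D') (b x)))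
      (f' (D' (b x))) 0 :=
    f'.hasFDerivAt.comp_hasDerivAt 0 (hasDerivAt_exp_smul_apply_zero D' (b x))
  have h0 : (fun s : k => f' (NormedSpace.exp (s • D') (b x))) = fun _ => 0 := by
    funext s
    exact hIf (hI (φ s) x hx)
  rw [h0] at h
  have h2 := h.unique (hasDerivAt_const _ _)
  apply hf
  simpa [f', hD'] using h2

/-- A non-zero ideal has an automorphic image that is not contained in `g₀`, if the pair is
almost effective. -/
theorem IsAlmostEffective.exists_lieEquiv_notMem {g₀ : LieSubalgebra k g}
    (heff : IsAlmostEffective g₀) {W : LieIdeal k g} (hW : W ≠ ⊥) :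
    ∃ φ : g ≃ₗ⁅k⁆ g, ∃ x ∈ W, φ x ∉ g₀ := by
  by_contra! h
  let N : LieIdeal k g :=
    { Submodule.span k {y | ∃ φ : g ≃ₗ⁅k⁆ g, ∃ x ∈ W, φ x = y} with
      lie_mem := by
        intro z m hm
        change m ∈ Submodule.span k _ at hm
        change ⁅z, m⁆ ∈ Submodule.span k _
        induction hm using Submodule.span_induction with
        | mem y hy =>
          obtain ⟨φ, x, hx, rfl⟩ := hy
          refine Submodule.subset_span ⟨φ, ⁅φ.symm z, x⁆, W.lie_mem hx, ?_⟩
          rw [LieEquiv.map_lie, LieEquiv.apply_symm_apply]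
        | zero => simp
        | add y y' _ _ h h' => rw [lie_add]; exact add_mem h h'
        | smul c y _ h => rw [lie_smul]; exact Submodule.smul_mem _ c h }
  have hN : ∀ x, x ∈ N ↔ x ∈ Submodule.span k {y | ∃ φ : g ≃ₗ⁅k⁆ g, ∃ x ∈ W, φ x = y} :=
    fun _ => Iff.rfl
  have hchar : IsCharacteristic N := by
    refine isCharacteristic_of_forall_lieEquiv N fun ψ m hm => ?_
    rw [hN] at hm ⊢
    induction hm using Submodule.span_induction with
    | mem y hy =>
      obtain ⟨φ, x, hx, rfl⟩ := hy
      exact Submodule.subset_span ⟨φ.trans ψ, x, hx, rfl⟩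
    | zero => simp
    | add y y' _ _ h h' => rw [map_add]; exact add_mem h h'
    | smul c y _ h => rw [map_smul]; exact Submodule.smul_mem _ c h
  have hbot := heff N hchar fun x hx => by
    rw [hN] at hx
    refine (Submodule.span_le (p := g₀.toSubmodule)).2 ?_ hx
    rintro _ ⟨φ, x, hx, rfl⟩
    exact h φ x hx
  refine hW ((LieSubmodule.eq_bot_iff _).2 fun x hx => ?_)
  have : x ∈ N := (hN x).2 (Submodule.subset_span ⟨LieEquiv.refl, x, hx, rfl⟩)
  rwa [hbot, LieSubmodule.mem_bot] at this

theorem isCharacteristic_radical : IsCharacteristic (LieAlgebra.radical k g) := by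
  refine isCharacteristic_of_forall_lieEquiv _ fun φ x hx => ?_
  let J : LieIdeal k g := (LieAlgebra.radical k g).comap φ.symm.toLieHom
  have hJ : ∀ y, y ∈ J ↔ φ.symm y ∈ LieAlgebra.radical k g := fun _ => LieIdeal.mem_comap
  let ψ : J →ₗ⁅k⁆ LieAlgebra.radical k g :=
    { toFun := fun y => ⟨φ.symm y, (hJ y).1 y.2⟩
      map_add' := fun _ _ => Subtype.ext (by simp)
      map_smul' := fun _ _ => Subtype.ext (by simp)
      map_lie' := Subtype.ext (φ.symm.toLieHom.map_lie _ _) }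
  have hψ : Function.Injective ψ := fun y z h =>
    Subtype.ext (φ.symm.injective (congrArg Subtype.val h))
  exact (LieAlgebra.LieIdeal.solvable_iff_le_radical k g J).1 hψ.lieAlgebra_isSolvable
    ((hJ _).2 (by simpa using hx))

theorem IsCharacteristic.lie {k g : Type*} [CommRing k] [LieRing g] [LieAlgebra k g]
    {I J : LieIdeal k g} (hI : IsCharacteristic I) (hJ : IsCharacteristic J) :
    IsCharacteristic ⁅I, J⁆ := by
  intro D x hx
  rw [← LieSubmodule.mem_toSubmodule, LieSubmodule.lieIdeal_oper_eq_linear_span'] at hx ⊢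
  induction hx using Submodule.span_induction with
  | mem y hy =>
    obtain ⟨a, ha, b, hb, rfl⟩ := hy
    rw [LieDerivation.apply_lie_eq_add]
    exact add_mem (Submodule.subset_span ⟨a, ha, D b, hJ D b hb, rfl⟩)
      (Submodule.subset_span ⟨D a, hI D a ha, b, hb, rfl⟩)
  | zero => simp
  | add y y' _ _ h h' => rw [map_add]; exact add_mem h h'
  | smul c y _ h => rw [map_smul]; exact Submodule.smul_mem _ c h

theorem IsCharacteristic.derivedSeriesOfIdeal {k g : Type*} [CommRing k] [LieRing g]
    [LieAlgebra k g] {I : LieIdeal k g} (hI : IsCharacteristic I) (n : ℕ) :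
    IsCharacteristic (LieAlgebra.derivedSeriesOfIdeal k g n I) := by
  induction n with
  | zero => exact hI
  | succ n ih => rw [LieAlgebra.derivedSeriesOfIdeal_succ]; exact ih.lie ih

theorem exists_isCharacteristic_isLieAbelian (h : ¬ LieAlgebra.HasTrivialRadical k g) :
    ∃ I : LieIdeal k g, IsCharacteristic I ∧ IsLieAbelian I ∧ I ≠ ⊥ := by
  refine ⟨LieAlgebra.derivedAbelianOfIdeal (LieAlgebra.radical k g), ?_,
    LieAlgebra.abelian_derivedAbelianOfIdeal _, fun h0 => h ⟨?_⟩⟩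
  · unfold LieAlgebra.derivedAbelianOfIdeal
    split
    · intro D x hx
      rw [LieSubmodule.mem_bot] at hx ⊢
      rw [hx, map_zero]
    · exact isCharacteristic_radical.derivedSeriesOfIdeal _
  · exact (LieAlgebra.abelian_of_solvable_ideal_eq_bot_iff _).1 h0

/-- The Killing form is non-degenerate in characteristic zero, so derivations are inner and preserve
every ideal. -/
theorem isSemisimple_and_isEffective {g₀ : LieSubalgebra k g}
    [LieAlgebra.HasTrivialRadical k g] (heff : IsAlmostEffective g₀) :
    LieAlgebra.IsSemisimple k g ∧ IsEffective g₀ := by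
  refine ⟨inferInstance, fun I hI => heff I (fun D x hx => ?_) hI⟩
  obtain ⟨y, rfl⟩ := LieDerivation.IsKilling.exists_eq_ad D
  rw [LieDerivation.ad_apply_apply]
  exact I.lie_mem hx

end Automorphisms

/-! ### Supplements and complements of abelian ideals. -/

section Splitting

variable {k g : Type*} [RCLike k] [LieRing g] [LieAlgebra k g]

theorem IsMaximalPair.exists_add_eq {g₀ : LieSubalgebra k g} (hmax : IsMaximalPair g₀)
    {I : LieIdeal k g} {y : g} (hy : y ∈ I) (hy₀ : y ∉ g₀) (x : g) :
    ∃ a ∈ g₀, ∃ b ∈ I, a + b = x := by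
  let S : LieSubalgebra k g :=
    { g₀.toSubmodule ⊔ I.toSubmodule with
      lie_mem' := by
        intro u v hu hv
        change u ∈ g₀.toSubmodule ⊔ I.toSubmodule at hu
        change v ∈ g₀.toSubmodule ⊔ I.toSubmodule at hv
        change ⁅u, v⁆ ∈ g₀.toSubmodule ⊔ I.toSubmodule
        obtain ⟨a, ha, b, hb, rfl⟩ := Submodule.mem_sup.1 hu
        obtain ⟨c, hc, d, hd, rfl⟩ := Submodule.mem_sup.1 hv
        refine Submodule.mem_sup.2 ⟨⁅a, c⁆, g₀.lie_mem ha hc, ⁅a, d⁆ + ⁅b, c + d⁆,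
          add_mem (lie_mem_right k g I a d hd) (lie_mem_left k g I b (c + d) hb), ?_⟩
        rw [add_lie, lie_add a c d, add_assoc] }
  have hS : ∀ z, z ∈ S ↔ z ∈ g₀.toSubmodule ⊔ I.toSubmodule := fun _ => Iff.rfl
  have htop : S = ⊤ := hmax.2 S (lt_of_le_of_ne
    (fun z hz => (hS z).2 (Submodule.mem_sup_left hz))
    (fun h => hy₀ (h ▸ (hS y).2 (Submodule.mem_sup_right hy))))
  exact Submodule.mem_sup.1 ((hS x).1 (htop ▸ LieSubalgebra.mem_top x))

variable [Module.Finite k g]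

/-- A supplement of an abelian ideal contains a complement of that ideal. -/
theorem exists_le_complement {g₀ : LieSubalgebra k g}
    (hmax : IsMaximalPair g₀) (heff : IsAlmostEffective g₀) {T : LieIdeal k g}
    (hT : ∀ x ∈ T, ∀ y ∈ T, ⁅x, y⁆ = 0) (S : LieSubalgebra k g)
    (hS : ∀ x, ∃ a ∈ S, ∃ t ∈ T, a + t = x) :
    ∃ A ≤ S, (∀ x, ∃ a ∈ A, ∃ t ∈ T, a + t = x) ∧ ∀ x ∈ A, x ∈ T → x = 0 := by
  induction hd : Module.finrank k S using Nat.strong_induction_on generalizing S with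
  | _ d ih =>
  subst hd
  by_cases h0 : ∀ x ∈ S, x ∈ T → x = 0
  · exact ⟨S, le_rfl, hS, h0⟩
  push Not at h0
  obtain ⟨w, hwS, hwT, hw⟩ := h0
  -- `S ∩ T` is an ideal because `g = S + T` and `T` is abelian.
  let W : LieIdeal k g :=
    { S.toSubmodule ⊓ T.toSubmodule with
      lie_mem := by
        rintro x m ⟨hmS, hmT⟩
        refine ⟨?_, T.lie_mem hmT⟩
        obtain ⟨a, ha, t, ht, rfl⟩ := hS x
        rw [add_lie, hT t ht m hmT, add_zero]
        exact S.lie_mem ha hmS }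
  have hW : ∀ z, z ∈ W ↔ z ∈ S ∧ z ∈ T := fun _ => Iff.rfl
  have hWbot : W ≠ ⊥ := fun h => hw ((LieSubmodule.eq_bot_iff _).1 h w ((hW w).2 ⟨hwS, hwT⟩))
  obtain ⟨φ, x, hx, hφx⟩ := heff.exists_lieEquiv_notMem hWbot
  -- Since `g = g₀ + φ(W)` and `W ⊆ S`, one has `S = A + W`, so `A` still supplements `T`; it is
  -- smaller than `S` because it misses `x`.
  let A := S ⊓ g₀.comap φ.toLieHom
  have hA : ∀ z, z ∈ A ↔ z ∈ S ∧ φ z ∈ g₀ := fun _ => Iff.rfl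
  have hφW : φ x ∈ W.comap φ.symm.toLieHom :=
    LieIdeal.mem_comap.2 (by simpa using hx)
  have hlt : Module.finrank k A < Module.finrank k S :=
    Submodule.finrank_lt_finrank_of_lt (s := A.toSubmodule) (t := S.toSubmodule)
      (lt_of_le_of_ne (fun z hz => ((hA z).1 hz).1) fun h =>
        hφx ((hA x).1 (show x ∈ A.toSubmodule from h ▸ ((hW x).1 hx).1)).2)
  obtain ⟨B, hBA, hB⟩ := ih _ hlt A (fun y => by
    obtain ⟨s, hs, t, ht, rfl⟩ := hS y
    obtain ⟨a, ha, b, hb, hab⟩ := hmax.exists_add_eq hφW hφx (φ s)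
    have hb' := (hW _).1 (LieIdeal.mem_comap.1 hb)
    have hab' : φ.symm a + φ.symm b = s := by rw [← map_add, hab, LieEquiv.symm_apply_apply]
    refine ⟨φ.symm a, (hA _).2 ⟨?_, by simpa using ha⟩, φ.symm b + t, add_mem hb'.2 ht, ?_⟩
    · rw [eq_sub_of_add_eq hab']
      exact sub_mem hs hb'.1
    · rw [← add_assoc, hab']) rfl
  exact ⟨B, hBA.trans fun z hz => ((hA z).1 hz).1, hB⟩

end Splitting

/-! ### A self-centralizing abelian ideal. -/

section Centralizer

variable {k g : Type*} [RCLike k] [LieRing g] [LieAlgebra k g] [Module.Finite k g]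

/-- If the radical is non-trivial, there is a non-zero characteristic abelian ideal that is its own
centralizer. -/
theorem exists_selfCentralizing {g₀ : LieSubalgebra k g}
    (hmax : IsMaximalPair g₀) (heff : IsAlmostEffective g₀)
    (h : ¬ LieAlgebra.HasTrivialRadical k g) :
    ∃ C : LieIdeal k g, IsCharacteristic C ∧ (∀ x ∈ C, ∀ y ∈ C, ⁅x, y⁆ = 0) ∧
      (∀ x, (∀ y ∈ C, ⁅x, y⁆ = 0) → x ∈ C) ∧ ∃ x ∈ C, x ∉ g₀ := by
  obtain ⟨I, hchar, hab, hI⟩ := exists_isCharacteristic_isLieAbelian h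
  obtain ⟨y, hyI, hy₀⟩ : ∃ y ∈ I, y ∉ g₀ := by
    by_contra! h
    exact hI (heff I hchar h)
  let C : LieIdeal k g := LieModule.ker k g I
  have hC : ∀ x, x ∈ C ↔ ∀ y ∈ I, ⁅x, y⁆ = 0 := fun x => by
    rw [LieModule.mem_ker]
    exact ⟨fun h y hy => congrArg Subtype.val (h ⟨y, hy⟩), fun h y => Subtype.ext (h y y.2)⟩
  have hIC : ∀ x ∈ I, x ∈ C := fun x hx => (hC x).2 fun y hy =>
    congrArg Subtype.val (hab.trivial ⟨x, hx⟩ ⟨y, hy⟩)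
  have hCchar : IsCharacteristic C := fun D x hx => (hC _).2 fun y hy => by
    have h := D.apply_lie_eq_add x y
    rw [(hC x).1 hx y hy, (hC x).1 hx _ (hchar D y hy), map_zero, zero_add] at h
    exact h.symm
  -- Modulo `I`, which `C` centralizes, elements of `C` can be moved into `g₀` without changing
  -- brackets. So `⁅C, C⁆` lies in `g₀`.
  have hbot : ⁅C, C⁆ = ⊥ := by
    refine heff _ (hCchar.lie hCchar) fun x hx => ?_
    rw [← LieSubmodule.mem_toSubmodule, LieSubmodule.lieIdeal_oper_eq_linear_span'] at hx
    refine (Submodule.span_le (p := g₀.toSubmodule)).2 ?_ hx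
    rintro _ ⟨u, hu, v, hv, rfl⟩
    obtain ⟨a, ha, b, hb, rfl⟩ := hmax.exists_add_eq hyI hy₀ u
    obtain ⟨c, hc, d, hd, rfl⟩ := hmax.exists_add_eq hyI hy₀ v
    have hb' : ⁅b, c + d⁆ = 0 := by rw [← lie_skew, (hC _).1 hv b hb, neg_zero]
    have ha' : a ∈ C := by simpa using sub_mem hu (hIC b hb)
    rw [add_lie, hb', add_zero, lie_add, (hC a).1 ha' d hd, add_zero]
    exact g₀.lie_mem ha hc
  refine ⟨C, hCchar, fun x hx y hy => ?_,
    fun x hx => (hC x).2 fun y hy => hx y (hIC y hy), y, hIC y hyI, hy₀⟩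
  have := LieSubmodule.lie_mem_lie hx hy
  rwa [hbot, LieSubmodule.mem_bot] at this

end Centralizer

/-! ### The common kernel of the homomorphisms to `V`. -/

section Isotypic

variable {k g : Type*} [RCLike k] [LieRing g] [LieAlgebra k g]

/-- The elements of an ideal `C` that are killed by every homomorphism from `C` to `V`. -/
def homKernel (C : LieIdeal k g) (V : Type*) [AddCommGroup V] [Module k V] [LieRingModule g V]
    [LieModule k g V] : LieIdeal k g where
  carrier := {x | ∃ h : x ∈ C, ∀ f : C →ₗ⁅k,g⁆ V, f ⟨x, h⟩ = 0}
  zero_mem' := ⟨C.zero_mem, fun f => f.map_zero⟩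
  add_mem' := fun ⟨hx, hx'⟩ ⟨hy, hy'⟩ => ⟨C.add_mem hx hy, fun f => by
    have := map_add f ⟨_, hx⟩ ⟨_, hy⟩
    rwa [hx', hy', add_zero] at this⟩
  smul_mem' := fun c x ⟨hx, hx'⟩ => ⟨C.smul_mem c hx, fun f => by
    have := map_smul f c ⟨x, hx⟩
    rwa [hx', smul_zero] at this⟩
  lie_mem := fun {z x} ⟨hx, hx'⟩ => ⟨C.lie_mem hx, fun f => by
    have := f.map_lie z ⟨x, hx⟩
    rw [hx', lie_zero] at this
    exact this⟩

theorem mem_homKernel {C : LieIdeal k g} {V : Type*} [AddCommGroup V] [Module k V]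
    [LieRingModule g V] [LieModule k g V] {x : g} :
    x ∈ homKernel C V ↔ ∃ h : x ∈ C, ∀ f : C →ₗ⁅k,g⁆ V, f ⟨x, h⟩ = 0 := Iff.rfl

variable [Module.Finite k g]

/-- A complement of `T` in `g` gives a projection `p` onto `T` that is equivariant on `C`. For `f :
C → V` and a derivation `D`, the composite `f ∘ D ∘ p` is again a homomorphism, so it kills `T`;
there `p` is the identity, so `f` kills `D T`. -/
theorem isCharacteristic_homKernel {g₀ : LieSubalgebra k g}
    (hmax : IsMaximalPair g₀) (heff : IsAlmostEffective g₀) {C : LieIdeal k g}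
    (hchar : IsCharacteristic C) (hC : ∀ x ∈ C, ∀ y ∈ C, ⁅x, y⁆ = 0)
    (V : Type*) [AddCommGroup V] [Module k V] [LieRingModule g V] [LieModule k g V] :
    IsCharacteristic (homKernel C V) := by
  set T := homKernel C V with hTdef
  have hTC : ∀ x ∈ T, x ∈ C := fun x hx => (mem_homKernel.1 hx).1
  obtain ⟨A, -, hA, hAT⟩ := exists_le_complement hmax heff (T := T)
    (fun x hx y hy => hC x (hTC x hx) y (hTC y hy)) ⊤
    (fun x => ⟨x, LieSubalgebra.mem_top x, 0, T.zero_mem, add_zero x⟩)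
  have hcompl : IsCompl T.toSubmodule A.toSubmodule := by
    refine ⟨Submodule.disjoint_def.2 fun x hx hx' => hAT x hx' hx, ?_⟩
    rw [codisjoint_iff, eq_top_iff]
    intro x _
    obtain ⟨a, ha, t, ht, rfl⟩ := hA x
    exact add_mem (Submodule.mem_sup_right ha) (Submodule.mem_sup_left ht)
  let p := T.toSubmodule.projection A.toSubmodule hcompl
  have hpT : ∀ x, p x ∈ T := fun x => by
    exact Submodule.projection_apply_mem hcompl x
  have hpt : ∀ x ∈ T, p x = x := fun x hx =>
    Submodule.projection_apply_left hcompl ⟨x, hx⟩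
  have hpa : ∀ x ∈ A, p x = 0 := fun x hx =>
    (Submodule.projection_apply_eq_zero_iff hcompl).2 hx
  have hpA : ∀ x, x - p x ∈ A := fun x =>
    (Submodule.projection_apply_eq_zero_iff hcompl).1
      (by rw [map_sub]; exact sub_eq_zero.2 (hpt _ (hpT x)).symm)
  have hplie : ∀ x : g, ∀ c ∈ C, p ⁅x, c⁆ = ⁅x, p c⁆ := by
    intro x c hc
    have h1 : ⁅x, c - p c⁆ ∈ A := by
      obtain ⟨a, ha, t, ht, rfl⟩ := hA x
      rw [add_lie, hC t (hTC t ht) _ (sub_mem hc (hTC _ (hpT c))), add_zero]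
      exact A.lie_mem ha (hpA c)
    have h2 := hpa _ h1
    rw [lie_sub, map_sub, sub_eq_zero] at h2
    rw [h2, hpt _ (T.lie_mem (hpT c))]
  intro D x hx
  refine mem_homKernel.2 ⟨hchar D x (hTC x hx), fun f => ?_⟩
  let F : C →ₗ⁅k,g⁆ V :=
    { toFun := fun c => f ⟨D (p c), hchar D _ (hTC _ (hpT c))⟩
      map_add' := fun c d => by
        rw [← map_add]
        congr 1
        exact Subtype.ext (by simp)
      map_smul' := fun r c => by
        rw [← map_smul]
        congr 1
        exact Subtype.ext (by simp)
      -- The defect of equivariance is `f ⁅D z, p c⁆`, which is zero since `⁅D z, p c⁆` lies in `T`.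
      map_lie' := fun {z c} => by
        obtain ⟨h, hf⟩ := mem_homKernel.1 (lie_mem_right k g T (D z) (p c) (hpT c))
        rw [← f.map_lie, ← sub_eq_zero, ← map_sub, ← hf f]
        congr 1
        refine Subtype.ext ?_
        change D (p ⁅z, (c : g)⁆) - ⁅z, D (p c)⁆ = ⁅D z, p c⁆
        rw [hplie z c c.2, LieDerivation.apply_lie_eq_add, add_sub_cancel_left] }
  have h0 := (mem_homKernel.1 hx).2 F
  change f ⟨D (p x), _⟩ = 0 at h0
  simpa only [hpt x hx] using h0

end Isotypic

/-! ### Simplicity of `C / (C ∩ g₀)`. -/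

section Quotient

variable {k g : Type*} [RCLike k] [LieRing g] [LieAlgebra k g]

/-- The intersection of an abelian ideal `C` and a subalgebra `g₀`, as a submodule of `C`, if
`g = g₀ + C`. -/
def interSubmodule (g₀ : LieSubalgebra k g) (C : LieIdeal k g)
    (hC : ∀ x ∈ C, ∀ y ∈ C, ⁅x, y⁆ = 0) (hadd : ∀ x, ∃ a ∈ g₀, ∃ b ∈ C, a + b = x) :
    LieSubmodule k g C where
  __ := g₀.toSubmodule.comap C.toSubmodule.subtype
  lie_mem := by
    rintro x ⟨c, hc⟩ hm
    change ⁅x, c⁆ ∈ g₀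
    obtain ⟨a, ha, b, hb, rfl⟩ := hadd x
    rw [add_lie, hC b hb c hc, add_zero]
    exact g₀.lie_mem ha hm

theorem mem_interSubmodule {g₀ : LieSubalgebra k g} {C : LieIdeal k g}
    {hC : ∀ x ∈ C, ∀ y ∈ C, ⁅x, y⁆ = 0} {hadd : ∀ x, ∃ a ∈ g₀, ∃ b ∈ C, a + b = x} {c : C} :
    c ∈ interSubmodule g₀ C hC hadd ↔ (c : g) ∈ g₀ := Iff.rfl

/-- The preimage in `C` of a non-zero submodule is an ideal not contained in `g₀`, so with `g₀` it
spans `g`, and with `C ∩ g₀` it spans `C`. -/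
theorem IsMaximalPair.isIrreducible_quotient {g₀ : LieSubalgebra k g} (hmax : IsMaximalPair g₀)
    {C : LieIdeal k g} (hC : ∀ x ∈ C, ∀ y ∈ C, ⁅x, y⁆ = 0)
    (hadd : ∀ x, ∃ a ∈ g₀, ∃ b ∈ C, a + b = x) {y : g} (hyC : y ∈ C) (hy₀ : y ∉ g₀) :
    LieModule.IsIrreducible k g (C ⧸ interSubmodule g₀ C hC hadd) := by
  set J := interSubmodule g₀ C hC hadd
  have hmk : ∀ c : C, LieSubmodule.Quotient.mk' J c = 0 ↔ (c : g) ∈ g₀ := fun c =>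
    (LieSubmodule.Quotient.mk_eq_zero' (N := J)).trans mem_interSubmodule
  have : Nontrivial (C ⧸ J) := ⟨_, 0, fun h => hy₀ ((hmk ⟨y, hyC⟩).1 h)⟩
  refine LieModule.IsIrreducible.mk fun N hN => ?_
  obtain ⟨v, hv, hv0⟩ : ∃ v ∈ N, v ≠ 0 := by
    by_contra! h
    exact hN ((LieSubmodule.eq_bot_iff N).2 h)
  obtain ⟨c, rfl⟩ := LieSubmodule.Quotient.surjective_mk' J v
  let N' : LieIdeal k g := (N.comap (LieSubmodule.Quotient.mk' J)).map (LieSubmodule.incl C)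
  have hN' : ∀ x, x ∈ N' ↔ ∃ d : C, LieSubmodule.Quotient.mk' J d ∈ N ∧ (d : g) = x := fun x =>
    LieSubmodule.mem_map x
  refine eq_top_iff.2 fun w _ => ?_
  obtain ⟨d, rfl⟩ := LieSubmodule.Quotient.surjective_mk' J w
  obtain ⟨a, ha, b, hb, hab⟩ := hmax.exists_add_eq ((hN' c).2 ⟨c, hv, rfl⟩)
    (fun h => hv0 ((hmk c).2 h)) (d : g)
  obtain ⟨e, he, rfl⟩ := (hN' b).1 hb
  have : LieSubmodule.Quotient.mk' J (d - e) = 0 := (hmk _).2 (by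
    rw [LieSubmodule.coe_sub, ← hab, add_sub_cancel_right]
    exact ha)
  rw [map_sub, sub_eq_zero] at this
  rw [this]
  exact he

end Quotient

/-! ### Identification of `C` with a power of `V`. -/

section Coordinates

variable {k g M V : Type*} [Field k] [LieRing g] [AddCommGroup M] [Module k M]
  [LieRingModule g M] [AddCommGroup V] [Module k V] [LieRingModule g V]

/-- If the homomorphisms from `M` to a simple module `V` separate points, then every non-zero
homomorphism is the last one of a system that identifies `M` with a power of `V`. -/
theorem exists_bijective_pi [Module.Finite k M] [LieModule.IsIrreducible k g V]
    (hsep : ∀ m : M, (∀ f : M →ₗ⁅k,g⁆ V, f m = 0) → m = 0) (q : M →ₗ⁅k,g⁆ V)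
    (hq : Function.Surjective q) :
    ∃ (n : ℕ) (F : Fin (n + 1) → (M →ₗ⁅k,g⁆ V)), F (Fin.last n) = q ∧
      Function.Bijective fun m i => F i m := by
  let P : ℕ → Prop := fun n => ∃ F : Fin (n + 1) → (M →ₗ⁅k,g⁆ V), F (Fin.last n) = q ∧
    Function.Surjective fun m i => F i m
  have : Module.Finite k V := Module.Finite.of_surjective (q : M →ₗ[k] V) hq
  have : Nontrivial V := LieModule.nontrivial_of_isIrreducible k g V
  have hP : ∀ n, P n → n + 1 ≤ Module.finrank k M := by
    rintro n ⟨F, -, hF⟩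
    have h := LinearMap.finrank_le_finrank_of_surjective
      (f := LinearMap.pi fun i => (F i : M →ₗ[k] V)) hF
    rw [Module.finrank_pi_fintype] at h
    simp only [Finset.sum_const, Finset.card_univ, Fintype.card_fin, smul_eq_mul] at h
    exact (Nat.le_mul_of_pos_right _ Module.finrank_pos).trans h
  have hP0 : P 0 := ⟨fun _ => q, rfl, fun v => by
    obtain ⟨m, hm⟩ := hq (v 0)
    exact ⟨m, funext fun i => by rw [Fin.fin_one_eq_zero i]; exact hm⟩⟩
  -- A maximal jointly surjective system is also injective.
  obtain ⟨n, hn, hn'⟩ : ∃ n, P n ∧ ¬ P (n + 1) := by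
    by_contra! h
    have hall : ∀ n, P n := fun n => Nat.rec hP0 (fun n => h n) n
    exact absurd (hP _ (hall (Module.finrank k M))) (by omega)
  obtain ⟨F, hlast, hF⟩ := hn
  refine ⟨n, F, hlast, (injective_iff_map_eq_zero
    (LinearMap.pi fun i => (F i : M →ₗ[k] V))).2 fun m hm => hsep m fun f => ?_, hF⟩
  by_contra hfm
  let N : LieSubmodule k g M :=
    { LinearMap.ker (LinearMap.pi fun i => (F i : M →ₗ[k] V)) with
      lie_mem := by
        intro x z hz
        refine funext fun i => ?_
        have hz' : F i z = 0 := congrFun hz i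
        change F i ⁅x, z⁆ = 0
        rw [(F i).map_lie, hz', lie_zero] }
  have hN : N.map f = ⊤ := by
    refine (IsSimpleOrder.eq_bot_or_eq_top (N.map f)).resolve_left fun h => hfm ?_
    exact (LieSubmodule.eq_bot_iff _).1 h _ (LieSubmodule.mem_map_of_mem hm)
  -- By simplicity `f` maps the common kernel onto `V`, so it extends the system; it is put first to
  -- keep `q` last.
  refine hn' ⟨Fin.cons f F, ?_, fun v => ?_⟩
  · rw [← Fin.succ_last, Fin.cons_succ, hlast]
  · obtain ⟨m₁, hm₁⟩ := hF (fun i => v i.succ)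
    obtain ⟨m₂, hm₂, h₂⟩ := (LieSubmodule.mem_map _).1
      (hN ▸ LieSubmodule.mem_top (v 0 - f m₁) : v 0 - f m₁ ∈ N.map f)
    refine ⟨m₁ + m₂, funext fun i => ?_⟩
    refine Fin.cases ?_ (fun j => ?_) i
    · simp [h₂]
    · have h₁ : F j m₁ = v j.succ := congrFun hm₁ j
      have h₀ : F j m₂ = 0 := congrFun hm₂ j
      simp [h₁, h₀]

end Coordinates

/-! ### Coordinates on `V ⊗ k ^ n`. -/

section IsotypicCoordinates

variable (k a V : Type*) [CommRing k] [AddCommGroup V] [Module k V]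

/-- The coordinates of an element of `V ⊗ k ^ n`, as a linear equivalence with `V ^ n`. -/
noncomputable def isotypicEquivPi (n : ℕ) : Isotypic k a V n ≃ₗ[k] (Fin n → V) :=
  TensorProduct.congr (LinearEquiv.refl k V) (TrivialLieModule.equiv k a (Fin n → k)) ≪≫ₗ
    TensorProduct.piScalarRight k k V (Fin n)

variable {k a V}

theorem isotypicEquivPi_tmul {n : ℕ} (v : V) (w : TrivialLieModule k a (Fin n → k)) (i : Fin n) :
    isotypicEquivPi k a V n (v ⊗ₜ w) i = TrivialLieModule.equiv k a (Fin n → k) w i • v := by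
  simp [isotypicEquivPi]

variable [LieRing a] [LieAlgebra k a] [LieRingModule a V] [LieModule k a V]

theorem isotypicEquivPi_lie {n : ℕ} (x : a) (m : Isotypic k a V n) (i : Fin n) :
    isotypicEquivPi k a V n ⁅x, m⁆ i = ⁅x, isotypicEquivPi k a V n m i⁆ := by
  induction m using TensorProduct.induction_on with
  | zero => simp
  | tmul v w =>
    rw [TensorProduct.LieModule.lie_tmul_right, LieModule.IsTrivial.trivial x w,
      TensorProduct.tmul_zero, add_zero, isotypicEquivPi_tmul, isotypicEquivPi_tmul, lie_smul]
  | add m m' h h' => rw [lie_add, map_add, map_add, Pi.add_apply, Pi.add_apply, lie_add, h, h']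

theorem isotypicEquivPi_map_trivialIncl {n : ℕ} (m : Isotypic k a V n) :
    (∀ i : Fin n, isotypicEquivPi k a V (n + 1)
      (TensorProduct.LieModule.map (LieModuleHom.id : V →ₗ⁅k,a⁆ V) (trivialIncl k a n) m)
        i.castSucc = isotypicEquivPi k a V n m i) ∧
    isotypicEquivPi k a V (n + 1)
      (TensorProduct.LieModule.map (LieModuleHom.id : V →ₗ⁅k,a⁆ V) (trivialIncl k a n) m)
        (Fin.last n) = 0 := by
  induction m using TensorProduct.induction_on with
  | zero => simp
  | tmul v w =>
    have h : TrivialLieModule.equiv k a (Fin (n + 1) → k) (trivialIncl k a n w) =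
        Function.extend Fin.castSucc (TrivialLieModule.equiv k a (Fin n → k) w) 0 := by
      simp [trivialIncl]; rfl
    rw [TensorProduct.LieModule.map_tmul]
    refine ⟨fun i => ?_, ?_⟩
    · rw [isotypicEquivPi_tmul, isotypicEquivPi_tmul, h,
        (Fin.castSucc_injective n).extend_apply]
      rfl
    · rw [isotypicEquivPi_tmul, h, Function.extend_apply', Pi.zero_apply, zero_smul]
      rintro ⟨i, hi⟩
      exact (Fin.castSucc_lt_last i).ne hi
  | add m m' h h' =>
    refine ⟨fun i => ?_, ?_⟩
    · rw [map_add, map_add, map_add, Pi.add_apply, Pi.add_apply, h.1, h'.1]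
    · rw [map_add, map_add, Pi.add_apply, h.2, h'.2, add_zero]

theorem mem_isotypicSub_iff {n : ℕ} {m : Isotypic k a V (n + 1)} :
    m ∈ isotypicSub k a V n ↔ isotypicEquivPi k a V (n + 1) m (Fin.last n) = 0 := by
  rw [isotypicSub, LieModuleHom.mem_range]
  constructor
  · rintro ⟨t, rfl⟩
    exact (isotypicEquivPi_map_trivialIncl t).2
  · intro h
    refine ⟨(isotypicEquivPi k a V n).symm fun i =>
      isotypicEquivPi k a V (n + 1) m i.castSucc, (isotypicEquivPi k a V (n + 1)).injective ?_⟩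
    funext i
    refine Fin.lastCases ?_ (fun j => ?_) i
    · rw [(isotypicEquivPi_map_trivialIncl _).2, h]
    · rw [(isotypicEquivPi_map_trivialIncl _).1, LinearEquiv.apply_symm_apply]

end IsotypicCoordinates

/-! ### Recognition of semidirect products. -/

section Decomposition

theorem Semidirect.mem_sub {k a M : Type*} [CommRing k] [LieRing a] [LieAlgebra k a]
    [AddCommGroup M] [Module k M] [LieRingModule a M] [LieModule k a M]
    {N : LieSubmodule k a M} {x : Semidirect k a M} :
    x ∈ Semidirect.sub N ↔ (AbelianLie.of k M).symm x.left ∈ N := Iff.rfl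

variable {k g : Type*} [CommRing k] [LieRing g] [LieAlgebra k g]

/-- A Lie algebra with an abelian ideal `C` and a complementary subalgebra `A` is the semidirect
product of `A` and any `A`-module isomorphic to `C`. -/
theorem exists_lieEquiv_semidirect (C : LieIdeal k g) (hC : ∀ x ∈ C, ∀ y ∈ C, ⁅x, y⁆ = 0)
    (A : LieSubalgebra k g) (hA : ∀ x, ∃ a ∈ A, ∃ c ∈ C, a + c = x)
    (hAC : ∀ x ∈ A, x ∈ C → x = 0) {M : Type*} [AddCommGroup M] [Module k M] [LieRingModule A M]
    [LieModule k A M] (E : C ≃ₗ[k] M) (hE : ∀ (a : A) (c : C), E ⁅(a : g), c⁆ = ⁅a, E c⁆) :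
    ∃ e : g ≃ₗ⁅k⁆ Semidirect k A M, ∀ (a : A) (c : C),
      (AbelianLie.of k M).symm (e (a + c)).left = E c := by
  let o := AbelianLie.of k M
  have hE' : ∀ (a : A) (m : M), ((E.symm ⁅a, m⁆ : C) : g) = ⁅(a : g), (E.symm m : g)⁆ := by
    intro a m
    have : E.symm ⁅a, m⁆ = ⁅(a : g), E.symm m⁆ := by
      rw [LinearEquiv.symm_apply_eq, hE, LinearEquiv.apply_symm_apply]
    rw [this]
    rfl
  let f : Semidirect k A M →ₗ⁅k⁆ g :=
    { toFun := fun x => x.right + E.symm (o.symm x.left)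
      map_add' := fun x y => by
        simp only [LieAlgebra.SemiDirectSum.add_eq_mk, map_add, AddMemClass.coe_add]
        abel
      map_smul' := fun r x => by
        simp only [LieAlgebra.SemiDirectSum.smul_eq_mk, map_smul, SetLike.val_smul,
          smul_add, RingHom.id_apply]
      map_lie' := fun {x y} => by
        have h : o.symm ⁅x, y⁆.left = ⁅x.right, o.symm y.left⁆ - ⁅y.right, o.symm x.left⁆ := by
          rw [LieAlgebra.SemiDirectSum.lie_eq_mk, AbelianLie.lie_eq_zero, zero_add, map_sub]
          rfl
        have h0 := hC _ (E.symm (o.symm x.left)).2 _ (E.symm (o.symm y.left)).2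
        rw [h, map_sub, LieSubmodule.coe_sub, hE', hE']
        change ⁅(x.right : g), (y.right : g)⁆ + _ = _
        rw [add_lie, lie_add, lie_add, h0, ← lie_skew (y.right : g)]
        abel }
  have hf : ∀ x, f x = x.right + E.symm (o.symm x.left) := fun _ => rfl
  have hbij : Function.Bijective f := by
    constructor
    · refine (injective_iff_map_eq_zero f).2 fun x hx => ?_
      rw [hf] at hx
      have h1 : (x.right : g) = 0 := hAC _ x.right.2 (by
        rw [eq_neg_of_add_eq_zero_left hx]
        exact neg_mem (E.symm (o.symm x.left)).2)
      rw [h1, zero_add] at hx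
      have h2 : E.symm (o.symm x.left) = 0 := Subtype.ext hx
      rw [LinearEquiv.map_eq_zero_iff, LinearEquiv.map_eq_zero_iff] at h2
      exact LieAlgebra.SemiDirectSum.ext h2 (Subtype.ext h1)
    · intro x
      obtain ⟨a, ha, c, hc, rfl⟩ := hA x
      exact ⟨⟨o (E ⟨c, hc⟩), ⟨a, ha⟩⟩, by simp [hf]⟩
  refine ⟨(LieEquiv.ofBijective f hbij).symm, fun a c => ?_⟩
  have : (LieEquiv.ofBijective f hbij).symm (a + c) = ⟨o (E c), a⟩ := by
    have h : (a : g) + c = LieEquiv.ofBijective f hbij ⟨o (E c), a⟩ := by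
      change _ = f _
      simp [hf]
    rw [h, LieEquiv.symm_apply_apply]
  rw [this]
  exact o.symm_apply_apply _

end Decomposition

end LiePair

/-! ### The classification. -/

theorem mainTheorem6 {k : Type u} [RCLike k] {g : Type v} [LieRing g] [LieAlgebra k g]
    [Module.Finite k g] (g₀ : LieSubalgebra k g)
    (hmax : LiePair.IsMaximalPair g₀) (heff : LiePair.IsAlmostEffective g₀) :
    (∃ (a V : Type v) (_ : LieRing a) (_ : LieAlgebra k a) (_ : AddCommGroup V) (_ : Module k V)
        (_ : LieRingModule a V) (_ : LieModule k a V) (n : ℕ)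
        (e : g ≃ₗ⁅k⁆ LiePair.Semidirect k a (LiePair.Isotypic k a V (n + 1))),
        LieModule.IsFaithful k a V ∧ LieModule.IsIrreducible k a V ∧
        ∀ x : g, x ∈ g₀ ↔ e x ∈ LiePair.Semidirect.sub (LiePair.isotypicSub k a V n)) ∨
    (LieAlgebra.IsSemisimple k g ∧ LiePair.IsMaximalPair g₀ ∧ LiePair.IsEffective g₀) := by
  by_cases hrad : LieAlgebra.HasTrivialRadical k g
  · have h := LiePair.isSemisimple_and_isEffective heff
    exact Or.inr ⟨h.1, hmax, h.2⟩
  left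
  obtain ⟨C, hchar, hC, hself, y, hyC, hy₀⟩ := LiePair.exists_selfCentralizing hmax heff hrad
  have hadd := hmax.exists_add_eq hyC hy₀
  have hirr := hmax.isIrreducible_quotient hC hadd hyC hy₀
  set J := LiePair.interSubmodule g₀ C hC hadd
  have hmk : ∀ c : C, LieSubmodule.Quotient.mk' J c = 0 ↔ (c : g) ∈ g₀ := fun c =>
    (LieSubmodule.Quotient.mk_eq_zero' (N := J)).trans LiePair.mem_interSubmodule
  have hker : LiePair.homKernel C (C ⧸ J) = ⊥ :=
    heff _ (LiePair.isCharacteristic_homKernel hmax heff hchar hC _) fun x hx => by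
      obtain ⟨h, hx'⟩ := LiePair.mem_homKernel.1 hx
      exact (hmk ⟨x, h⟩).1 (hx' _)
  obtain ⟨n, F, hlast, hF⟩ := LiePair.exists_bijective_pi (M := C) (V := C ⧸ J)
    (fun m hm => Subtype.ext ((LieSubmodule.eq_bot_iff _).1 hker m
      (LiePair.mem_homKernel.2 ⟨m.2, hm⟩)))
    (LieSubmodule.Quotient.mk' J) (LieSubmodule.Quotient.surjective_mk' J)
  obtain ⟨A, hA₀, hA, hAC⟩ := LiePair.exists_le_complement hmax heff hC g₀ hadd
  have hCV : ∀ c ∈ C, ∀ v : C ⧸ J, ⁅c, v⁆ = 0 := fun c hc v => by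
    obtain ⟨d, rfl⟩ := LieSubmodule.Quotient.surjective_mk' J v
    rw [← LieModuleHom.map_lie, (Subtype.ext (hC c hc d d.2) : ⁅c, d⁆ = 0), map_zero]
  let E : C ≃ₗ[k] LiePair.Isotypic k A (C ⧸ J) (n + 1) :=
    LinearEquiv.ofBijective (LinearMap.pi fun i => (F i : C →ₗ[k] C ⧸ J)) hF ≪≫ₗ
      (LiePair.isotypicEquivPi k A (C ⧸ J) (n + 1)).symm
  have hE : ∀ c i, LiePair.isotypicEquivPi k A (C ⧸ J) (n + 1) (E c) i = F i c := fun c i => by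
    simp only [E, LinearEquiv.trans_apply, LinearEquiv.apply_symm_apply]
    rfl
  obtain ⟨e, he⟩ := LiePair.exists_lieEquiv_semidirect C hC A hA hAC E fun a c => by
    apply (LiePair.isotypicEquivPi k A (C ⧸ J) (n + 1)).injective
    funext i
    rw [LiePair.isotypicEquivPi_lie, hE, hE, LieModuleHom.map_lie]
    rfl
  refine ⟨A, C ⧸ J, inferInstance, inferInstance, inferInstance, inferInstance, inferInstance,
    inferInstance, n, e, ?_, ?_, fun x => ?_⟩
  -- An element of `A` that kills `V` kills `C`, a power of `V`; so it lies in `C ∩ A = 0`.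
  · refine (LieModule.isFaithful_iff' k A (C ⧸ J)).2 fun a ha => ?_
    refine Subtype.ext (hAC a a.2 (hself a fun c hc => ?_))
    refine congrArg Subtype.val (hF.injective (a₁ := ⁅(a : g), (⟨c, hc⟩ : C)⁆) (a₂ := 0) ?_)
    funext i
    rw [LieModuleHom.map_lie, map_zero]
    exact ha _
  · have : Nontrivial (C ⧸ J) := LieModule.nontrivial_of_isIrreducible k g _
    refine LieModule.IsIrreducible.mk fun N hN => ?_
    -- `C` acts trivially on `V`, so submodules over `A` and over `g` agree.
    let N' : LieSubmodule k g (C ⧸ J) :=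
      { N.toSubmodule with
        lie_mem := by
          intro x m hm
          obtain ⟨a, ha, c, hc, rfl⟩ := hA x
          rw [add_lie, hCV c hc, add_zero]
          exact N.lie_mem (x := (⟨a, ha⟩ : A)) hm }
    have hN' : ∀ m, m ∈ N' ↔ m ∈ N := fun _ => Iff.rfl
    rcases IsSimpleOrder.eq_bot_or_eq_top N' with h | h
    · exact absurd ((LieSubmodule.eq_bot_iff N).2 fun m hm =>
        (LieSubmodule.eq_bot_iff N').1 h m ((hN' m).2 hm)) hN
    · exact eq_top_iff.2 fun m _ => (hN' m).1 (h ▸ LieSubmodule.mem_top m)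
  · obtain ⟨a, ha, c, hc, rfl⟩ := hA x
    rw [LiePair.Semidirect.mem_sub, he ⟨a, ha⟩ ⟨c, hc⟩, LiePair.mem_isotypicSub_iff, hE, hlast, hmk]
    exact ⟨fun h => by simpa using sub_mem h (hA₀ ha), fun h => add_mem (hA₀ ha) h⟩
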